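/- Let $m\ge 1$ and $n\ge 3$ be integers. Let $W_n$ be the wheel with $n+1$ vertices and $2n$ edges (a hub joined to every vertex of a cycle $C_n$), and fix a vertex $r$ of $W_n$. Define graphs $G^{(i)}=G^{(i,m,n)}$, $i\ge 0$, by $G^{(0)}=W_n$, where $G^{(i+1)}$ is obtained from $G^{(i)}$ by replacing every edge with a path of length $m$ (adding $m-1$ new vertices per edge) and attaching to every vertex $v$ of $G^{(i)}$ (but not to the new vertices subdividing the edges) a new copy of $W_n$, by identifying the vertex $r$ of the copy with $v$. Put $|V^{(0)}|=1$ and let $|V^{(i+1)}|$ be the number of vertices of $G^{(i)}$ for $i\ge 0$. Let $L_k$ be the Lucas numbers, $L_1=1$, $L_2=3$, $L_{k+2}=L_{k+1}+L_k$. Then for every $i\ge 0$ the number of spanning trees of $G^{(i)}$ is $$\tau(G^{(i)})=(L_{2n}-2)^{\sum_{j=0}^{i}|V^{(j)}|}\; m^{\,n\sum_{j=0}^{i}(i-j)|V^{(j)}|}.$$ Moreover $|V^{(0)}|=1$, $|V^{(1)}|=n+1$, and for all $i\ge 2$ $$|V^{(i)}|=(n+m+1)\,|V^{(i-1)}|+(mn-m-2n)\,|V^{(i-2)}|.$$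 -/

import Mathlib

/-- The Lucas numbers: `L₀ = 2`, `L₁ = 1`, `L_{k+2} = L_{k+1} + L_k` (so `L₂ = 3`). -/
def lucas : ℕ → ℕ
  | 0 => 2
  | 1 => 1
  | k + 2 => lucas (k + 1) + lucas k

/-- The wheel `W_n`: the hub `none` joined to every vertex of the rim cycle `C_n` on `Fin n`. -/
def wheelGraph (n : ℕ) : SimpleGraph (Option (Fin n)) where
  Adj
    | none, none => False
    | none, some _ => True
    | some _, none => True
    | some a, some b => (SimpleGraph.cycleGraph n).Adj a b
  symm := ⟨by
    rintro (_ | a) (_ | b) h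
    · exact h
    · trivial
    · trivial
    · exact SimpleGraph.Adj.symm h⟩
  loopless := ⟨by
    rintro (_ | a) h
    · exact h
    · exact SimpleGraph.irrefl _ h⟩

/-- The number of spanning trees of a graph: the number of trees on the full vertex set all of
whose edges are edges of `G`. -/
noncomputable def spanningTreeCount {V : Type} (G : SimpleGraph V) : ℕ :=
  Nat.card {T : SimpleGraph V // T ≤ G ∧ T.IsTree}

/-- The vertices of the graph obtained from `G` by replacing each edge with a path of length `m`:
the old vertices, and `m - 1` new ones for each edge. -/
abbrev EdgePathVertex {V : Type} (G : SimpleGraph V) (m : ℕ) : Type :=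
  V ⊕ G.edgeSet × Fin (m - 1)

/-- The `k`-th point (`0 ≤ k ≤ m`) of the path of length `m` that replaces the edge `e`. The points
`0` and `m` are the two ends of `e`, in an arbitrarily chosen order; the points in between are the
`m - 1` new vertices that belong to `e`. -/
noncomputable def edgePathPoint {V : Type} (G : SimpleGraph V) (m : ℕ) (e : G.edgeSet) (k : ℕ) :
    EdgePathVertex G m :=
  if h0 : k = 0 then Sum.inl (Quot.out e.1).1
  else if hm : k < m then Sum.inr (e, ⟨k - 1, by omega⟩)
  else Sum.inl (Quot.out e.1).2

/-- Edge-path transformation: every edge of `G` is replaced with a path of length `m`. -/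
noncomputable def edgePathGraph {V : Type} (G : SimpleGraph V) (m : ℕ) :
    SimpleGraph (EdgePathVertex G m) :=
  SimpleGraph.fromEdgeSet
    {s | ∃ (e : G.edgeSet) (k : ℕ), k < m ∧ s = s(edgePathPoint G m e k, edgePathPoint G m e (k + 1))}

/-- The vertices of the graph obtained from a graph on `X` by attaching, for each `v : V`, a new
copy of a graph on `B` whose vertex `r` is identified with a vertex already present. -/
abbrev LinkVertex (X V : Type) {B : Type} (r : B) : Type :=
  X ⊕ V × {b : B // b ≠ r}

open Classical in
/-- The vertex `b` of the copy attached at `v`; the root `r` of this copy is the old vertex `f v`. -/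
noncomputable def linkPoint {X V B : Type} (f : V → X) (r : B) (v : V) (b : B) :
    LinkVertex X V r :=
  if h : b = r then Sum.inl (f v) else Sum.inr (v, ⟨b, h⟩)

/-- Graph-linking at vertices: to each vertex `f v` of `G` a new copy of the graph `K` is attached,
by identifying the vertex `r` of the copy with `f v`. -/
noncomputable def graphLink {X V B : Type} (G : SimpleGraph X) (f : V → X) (K : SimpleGraph B)
    (r : B) : SimpleGraph (LinkVertex X V r) :=
  SimpleGraph.fromEdgeSet
    (Sym2.map Sum.inl '' G.edgeSet ∪ ⋃ v : V, Sym2.map (linkPoint f r v) '' K.edgeSet)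

/-- A graph together with its vertex type. -/
structure BundledGraph where
  /-- The vertex type. -/
  Vertex : Type
  /-- The graph. -/
  graph : SimpleGraph Vertex

/-- The self-similar graph `G^{(i,m,n)}` based on `W_n`. It starts from `G^{(0,m,n)} = W_n`; then
`G^{(i+1,m,n)}` arises by replacing each edge of `G^{(i,m,n)}` with a path of length `m` and
attaching a new copy of `W_n`, by its vertex `r`, to each vertex of `G^{(i,m,n)}` (not to the
vertices that subdivide the edges). -/
noncomputable def wheelFractal (m n : ℕ) (r : Option (Fin n)) : ℕ → BundledGraph
  | 0 => ⟨Option (Fin n), wheelGraph n⟩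
  | i + 1 =>
    let G := (wheelFractal m n r i).graph
    ⟨_, graphLink (edgePathGraph G m) Sum.inl (wheelGraph n) r⟩

/-- The vertex counts `|V^{(j)}|`: `|V^{(0)}| = 1`, and `|V^{(i+1)}|` is the number of vertices of
`G^{(i,m,n)}`. -/
noncomputable def wheelFractalOrder (m n : ℕ) (r : Option (Fin n)) : ℕ → ℕ
  | 0 => 1
  | i + 1 => Nat.card (wheelFractal m n r i).Vertex

/-! The two operations act on spanning trees independently, and the wheel is counted by a transfer
matrix. Trees are handled as connecting edge sets with one edge fewer than there are vertices.
Subdividing: a spanning tree of the subdivided graph omits at most one part of each old edge, and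
the edges left whole form a spanning tree of `G`. Each of the `|E| - |V| + 1` other edges loses one
of its `m` parts, so `τ` gains the factor `m` to the cyclomatic number (`treeSetCount_pathPoint`).
Linking: copies glued at single vertices carry independent trees, so `τ` is multiplied by `τ(W_n)`
once per attached copy (`treeSetCount_linkEnd`). Subdivision keeps the cyclomatic number and each
wheel adds `n` to it (`cyclomatic_wheelFractal`); the product formula follows by induction. For the
wheel, an edge set without the full rim is a spanning tree exactly when every maximal stretch of rim
has one spoke. A two-state automaton going round the rim checks this; its closed words number `trace
(M ^ n) = L_{2n}` with `M = !![2, 1; 1, 1]`. Two of these words have the full rim and are not trees;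
the rest correspond to trees (`treeSetCount_wheel`). -/

/-! ### Spanning trees as sets of edges -/

/-- The set `S` of edges connects the graph whose edge `e` has the ends `a e` and `b e`: a property
of vertices that is constant along the edges in `S` is constant. -/
def IsConnecting {V E : Type} (a b : E → V) (S : Set E) : Prop :=
  ∀ f : V → Prop, (∀ e ∈ S, (f (a e) ↔ f (b e))) → ∀ u v, f u ↔ f v

/-- The set `S` of edges is a spanning tree of the graph with edge ends `a` and `b`. -/
def IsSpanningTreeSet {V E : Type} (a b : E → V) (S : Set E) : Prop :=
  IsConnecting a b S ∧ S.ncard + 1 = Nat.card V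

/-- The number of spanning trees, as edge sets, of the graph with edge ends `a` and `b`. -/
noncomputable def treeSetCount {V E : Type} (a b : E → V) : ℕ :=
  Nat.card {S : Set E // IsSpanningTreeSet a b S}

/-- The edges of `G` are, without repetition, the pairs `s(a e, b e)`. -/
structure IsEdgeListing {V E : Type} (G : SimpleGraph V) (a b : E → V) : Prop where
  injective : Function.Injective fun e => s(a e, b e)
  range_eq : Set.range (fun e => s(a e, b e)) = G.edgeSet

theorem connected_iff_forall_prop {V : Type} [Nonempty V] (T : SimpleGraph V) :
    T.Connected ↔ ∀ f : V → Prop, (∀ u v, T.Adj u v → (f u ↔ f v)) → ∀ u v, f u ↔ f v := by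
  constructor
  · intro h f hf u v
    obtain ⟨w⟩ := h.preconnected u v
    induction w with
    | nil => rfl
    | cons hadj _ ih => exact (hf _ _ hadj).trans ih
  · intro h
    refine ⟨fun u v => ?_⟩
    refine (h (fun x => T.Reachable u x) (fun x y hxy => ?_) u v).1 (SimpleGraph.Reachable.refl u)
    exact ⟨fun h => h.trans hxy.reachable, fun h => h.trans hxy.symm.reachable⟩

theorem isConnecting_iff_connected_fromEdgeSet {V E : Type} [Nonempty V] (a b : E → V)
    (S : Set E) :
    IsConnecting a b S ↔
      (SimpleGraph.fromEdgeSet ((fun e => s(a e, b e)) '' S)).Connected := by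
  rw [connected_iff_forall_prop]
  refine forall_congr' fun f => imp_congr_left ⟨fun h u v huv => ?_, fun h e he => ?_⟩
  · obtain ⟨⟨e, he, heq⟩, -⟩ := (SimpleGraph.fromEdgeSet_adj _).1 huv
    rcases Sym2.eq_iff.1 heq with ⟨rfl, rfl⟩ | ⟨rfl, rfl⟩
    · exact h e he
    · exact (h e he).symm
  -- A loop disappears in the simple graph, but the condition it imposes is trivial.
  · by_cases hab : a e = b e
    · rw [hab]
    · exact h _ _ ((SimpleGraph.fromEdgeSet_adj _).2 ⟨⟨e, he, rfl⟩, hab⟩)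

theorem IsConnecting.card_le {V E : Type} [Nonempty V] [Finite E] {a b : E → V}
    {S : Set E} (h : IsConnecting a b S) : Nat.card V ≤ S.ncard + 1 := by
  have hc := ((isConnecting_iff_connected_fromEdgeSet a b S).1 h).card_vert_le_card_edgeSet_add_one
  refine hc.trans (Nat.add_le_add_right ?_ 1)
  rw [SimpleGraph.edgeSet_fromEdgeSet, Nat.card_coe_set_eq]
  exact (Set.ncard_le_ncard Set.sdiff_subset (S.toFinite.image _)).trans
    (Set.ncard_image_le S.toFinite)

theorem IsEdgeListing.ne {V E : Type} {G : SimpleGraph V} {a b : E → V}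
    (h : IsEdgeListing G a b) (e : E) : a e ≠ b e := by
  have : s(a e, b e) ∈ G.edgeSet := h.range_eq ▸ ⟨e, rfl⟩
  exact SimpleGraph.Adj.ne this

theorem IsEdgeListing.card_edgeSet {V E : Type} {G : SimpleGraph V} {a b : E → V}
    (h : IsEdgeListing G a b) : Nat.card G.edgeSet = Nat.card E := by
  rw [← h.range_eq]
  exact Nat.card_range_of_injective h.injective

theorem isEdgeListing_out {V : Type} (G : SimpleGraph V) :
    IsEdgeListing G (fun e : G.edgeSet => (Quot.out e.1).1) (fun e => (Quot.out e.1).2) := by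
  have key (e : G.edgeSet) : s((Quot.out e.1).1, (Quot.out e.1).2) = e.1 := Quot.out_eq e.1
  refine ⟨fun e e' hee => ?_, ?_⟩
  · exact Subtype.ext ((key e).symm.trans (hee.trans (key e')))
  · simp only [key, Subtype.range_coe]

theorem isEdgeListing_fromEdgeSet {V E : Type} {a b : E → V}
    (hinj : Function.Injective fun e => s(a e, b e)) (hne : ∀ e, a e ≠ b e) :
    IsEdgeListing (SimpleGraph.fromEdgeSet (Set.range fun e => s(a e, b e))) a b := by
  refine ⟨hinj, ?_⟩
  rw [SimpleGraph.edgeSet_fromEdgeSet, eq_comm, sdiff_eq_left, Set.disjoint_left]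
  rintro _ ⟨e, rfl⟩ h
  exact hne e (by simpa using h)

theorem IsEdgeListing.edgeSet_fromEdgeSet_image {V E : Type} {G : SimpleGraph V} {a b : E → V}
    (h : IsEdgeListing G a b) (S : Set E) :
    (SimpleGraph.fromEdgeSet ((fun e => s(a e, b e)) '' S)).edgeSet =
      (fun e => s(a e, b e)) '' S := by
  rw [SimpleGraph.edgeSet_fromEdgeSet, sdiff_eq_left, Set.disjoint_left]
  rintro _ ⟨e, -, rfl⟩ hd
  exact h.ne e (by simpa using hd)

theorem IsEdgeListing.isSpanningTreeSet_iff {V E : Type} [Finite V] [Nonempty V]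
    {G : SimpleGraph V} {a b : E → V} (h : IsEdgeListing G a b) (S : Set E) :
    IsSpanningTreeSet a b S ↔
      (SimpleGraph.fromEdgeSet ((fun e => s(a e, b e)) '' S)).IsTree := by
  rw [SimpleGraph.isTree_iff_connected_and_card, ← isConnecting_iff_connected_fromEdgeSet,
    h.edgeSet_fromEdgeSet_image, Nat.card_coe_set_eq, Set.ncard_image_of_injective S h.injective]
  rfl

theorem spanningTreeCount_eq_treeSetCount {V E : Type} [Finite V] [Nonempty V]
    {G : SimpleGraph V} {a b : E → V} (h : IsEdgeListing G a b) :
    spanningTreeCount G = treeSetCount a b := by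
  refine (Nat.card_eq_of_bijective (fun S : {S : Set E // IsSpanningTreeSet a b S} =>
    (⟨SimpleGraph.fromEdgeSet ((fun e => s(a e, b e)) '' S.1), ?_,
      (h.isSpanningTreeSet_iff S.1).1 S.2⟩ : {T : SimpleGraph V // T ≤ G ∧ T.IsTree}))
    ⟨?_, ?_⟩).symm
  · rw [← SimpleGraph.edgeSet_subset_edgeSet, h.edgeSet_fromEdgeSet_image, ← h.range_eq]
    exact Set.image_subset_range _ _
  · intro S S' hS
    have := congrArg SimpleGraph.edgeSet (Subtype.ext_iff.1 hS)
    simp only [h.edgeSet_fromEdgeSet_image] at this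
    exact Subtype.ext (h.injective.image_injective this)
  · rintro ⟨T, hTG, hT⟩
    have himg : (fun e => s(a e, b e)) '' ((fun e => s(a e, b e)) ⁻¹' T.edgeSet) = T.edgeSet := by
      rw [Set.image_preimage_eq_inter_range, h.range_eq, Set.inter_eq_left]
      exact SimpleGraph.edgeSet_subset_edgeSet.2 hTG
    refine ⟨⟨(fun e => s(a e, b e)) ⁻¹' T.edgeSet, ?_⟩, ?_⟩
    · rw [h.isSpanningTreeSet_iff, himg, SimpleGraph.fromEdgeSet_edgeSet]
      exact hT
    · simp only [himg, SimpleGraph.fromEdgeSet_edgeSet]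

/-! ### Replacing edges with paths -/

/-- The `k`-th point of the path of length `m` that replaces the edge `e`. -/
def pathPoint {V E : Type} (a b : E → V) (m : ℕ) (e : E) (k : ℕ) : V ⊕ E × Fin (m - 1) :=
  if _h0 : k = 0 then Sum.inl (a e)
  else if hm : k < m then Sum.inr (e, ⟨k - 1, by omega⟩)
  else Sum.inl (b e)

theorem pathPoint_zero {V E : Type} (a b : E → V) (m : ℕ) (e : E) :
    pathPoint a b m e 0 = Sum.inl (a e) := by
  simp [pathPoint]

theorem pathPoint_end {V E : Type} (a b : E → V) {m : ℕ} (hm : 1 ≤ m) (e : E) :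
    pathPoint a b m e m = Sum.inl (b e) := by
  have : m ≠ 0 := by omega
  simp [pathPoint, this]

theorem pathPoint_succ {V E : Type} (a b : E → V) {m : ℕ} (e : E) (j : Fin (m - 1)) :
    pathPoint a b m e (j + 1) = Sum.inr (e, j) := by
  have : (j : ℕ) + 1 < m := by omega
  simp [pathPoint, this]

/-- The edges all of whose parts lie in `S`. -/
def fullEdges {E : Type} {m : ℕ} (S : Set (E × Fin m)) : Set E := {e | ∀ k, (e, k) ∈ S}

theorem iff_pathPoint_of_forall_mem {V E : Type} {a b : E → V} {m : ℕ} {S : Set (E × Fin m)}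
    {f : V ⊕ E × Fin (m - 1) → Prop}
    (hf : ∀ x ∈ S, (f (pathPoint a b m x.1 x.2) ↔ f (pathPoint a b m x.1 (x.2 + 1)))) (e : E)
    {i j : ℕ} (hij : i ≤ j) (hS : ∀ k : Fin m, i ≤ k → k < j → (e, k) ∈ S) (hj : j ≤ m) :
    f (pathPoint a b m e i) ↔ f (pathPoint a b m e j) := by
  induction j, hij using Nat.le_induction with
  | base => rfl
  | succ j hij ih =>
    refine (ih (fun k h1 h2 => hS k h1 (by omega)) (by omega)).trans ?_
    exact hf (e, ⟨j, by omega⟩) (hS ⟨j, by omega⟩ hij (by simp))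

/-- Two missing parts of one edge cut off the stretch between them. With a single part missing, each
inner point still hangs on one end, but the path no longer joins its ends. -/
theorem isConnecting_pathPoint_iff {V E : Type} (a b : E → V) {m : ℕ} (hm : 1 ≤ m)
    (S : Set (E × Fin m)) :
    IsConnecting (fun x : E × Fin m => pathPoint a b m x.1 x.2)
        (fun x => pathPoint a b m x.1 (x.2 + 1)) S ↔
      Set.InjOn Prod.fst Sᶜ ∧ IsConnecting a b (fullEdges S) := by
  classical
  constructor
  · intro h
    constructor
    · have key (e : E) (k l : Fin m) (hk : (e, k) ∉ S) (hl : (e, l) ∉ S) (hkl : k < l) :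
          False := by
        have hkl' : (k : ℕ) < l := hkl
        -- Indicator of the points `k + 1, ..., l` on the path of `e`, between the missing parts `k`
        -- and `l`; the inner vertex with index `j` is point `j + 1`.
        let f : V ⊕ E × Fin (m - 1) → Prop :=
          Sum.elim (fun _ => False) (fun x => x.1 = e ∧ (k : ℕ) ≤ x.2 ∧ (x.2 : ℕ) < l)
        have hfp (e' : E) (j : ℕ) :
            f (pathPoint a b m e' j) ↔ e' = e ∧ (k : ℕ) < j ∧ j ≤ l := by
          unfold pathPoint
          split_ifs with h0 h1
          · simp [f, h0]
          · simp only [f, Sum.elim_inr]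
            refine and_congr_right fun _ => ?_
            constructor <;> (rintro ⟨h2, h3⟩; constructor <;> omega)
          · simp only [f, Sum.elim_inl, false_iff]
            rintro ⟨-, -, h3⟩
            omega
        have := h f (fun x hx => by
          simp only [hfp]
          refine and_congr_right fun hxe => ?_
          have h1 : (x.2 : ℕ) ≠ k := by
            intro h1
            have : x = (e, k) := Prod.ext hxe (Fin.ext h1)
            exact hk (this ▸ hx)
          have h2 : (x.2 : ℕ) ≠ l := by
            intro h2
            have : x = (e, l) := Prod.ext hxe (Fin.ext h2)
            exact hl (this ▸ hx)
          omega) (pathPoint a b m e (k + 1)) (pathPoint a b m e 0)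
        rw [hfp, hfp] at this
        have := this.1 ⟨rfl, by omega, by omega⟩
        omega
      rintro ⟨e, k⟩ hk ⟨e', l⟩ hl (rfl : e = e')
      rcases lt_trichotomy k l with hkl | rfl | hkl
      · exact (key e k l hk hl hkl).elim
      · rfl
      · exact (key e l k hl hk hkl).elim
    · intro f hf u v
      -- Extension of `f` along the path: the value at the start up to the first missing part, the
      -- value at the far end after it.
      let g (e : E) (j : ℕ) : Prop :=
        if ∀ k : Fin m, (k : ℕ) < j → (e, k) ∈ S then f (a e) else f (b e)
      let F : V ⊕ E × Fin (m - 1) → Prop := Sum.elim f (fun x => g x.1 (x.2 + 1))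
      have hF (e : E) (j : ℕ) : F (pathPoint a b m e j) ↔ g e j := by
        unfold pathPoint
        split_ifs with h0 h1
        · simp [F, g, h0]
        · simp only [F, Sum.elim_inr]
          rw [Nat.sub_add_cancel (by omega)]
        · simp only [F, Sum.elim_inl, g]
          split_ifs with h2
          · exact (hf e fun k => h2 k (by omega)).symm
          · rfl
      refine h F (fun x hx => ?_) (Sum.inl u) (Sum.inl v)
      rw [hF, hF]
      have : (∀ k : Fin m, (k : ℕ) < x.2 → (x.1, k) ∈ S) ↔
          ∀ k : Fin m, (k : ℕ) < x.2 + 1 → (x.1, k) ∈ S := by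
        refine ⟨fun h k hk => ?_, fun h k hk => h k (by omega)⟩
        rcases Nat.lt_succ_iff_lt_or_eq.1 hk with hk | hk
        · exact h k hk
        · rwa [Fin.ext hk]
      simp only [g, this]
  · rintro ⟨hinj, hconn⟩ f hf
    have hV : ∀ u v : V, f (Sum.inl u) ↔ f (Sum.inl v) := by
      refine hconn (fun v => f (Sum.inl v)) fun e he => ?_
      have := iff_pathPoint_of_forall_mem hf e (Nat.zero_le m) (fun k _ _ => he k) le_rfl
      rwa [pathPoint_zero, pathPoint_end a b hm] at this
    have hE (e : E) (j : Fin (m - 1)) : f (Sum.inr (e, j)) ↔ f (Sum.inl (a e)) := by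
      rw [← pathPoint_succ a b]
      -- If a part before the point is missing, it is the only one, so the point is tied to the far
      -- end, where `f` agrees with the start by `hV`.
      by_cases hall : ∀ k : Fin m, (k : ℕ) < j + 1 → (e, k) ∈ S
      · rw [← pathPoint_zero a b m e]
        exact (iff_pathPoint_of_forall_mem hf e (Nat.zero_le _) (fun k _ => hall k)
          (by omega)).symm
      · push Not at hall
        obtain ⟨k, hk, hkS⟩ := hall
        rw [hV (a e) (b e), ← pathPoint_end a b hm e]
        refine iff_pathPoint_of_forall_mem hf e (by omega) (fun l hl _ => ?_) le_rfl
        by_contra hlS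
        have : l = k := congrArg Prod.snd (hinj hlS hkS rfl)
        omega
    rintro (u | ⟨e, j⟩) (v | ⟨e', j'⟩)
    · exact hV u v
    · exact (hV _ _).trans (hE e' j').symm
    · exact (hE e j).trans (hV _ _)
    · exact (hE e j).trans ((hV _ _).trans (hE e' j').symm)

theorem ncard_add_ncard_compl_fullEdges {E : Type} [Finite E] {m : ℕ} {S : Set (E × Fin m)}
    (hS : Set.InjOn Prod.fst Sᶜ) : S.ncard + (fullEdges S)ᶜ.ncard = Nat.card E * m := by
  have himg : Prod.fst '' Sᶜ = (fullEdges S)ᶜ := by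
    ext e
    simp [fullEdges]
  rw [← himg, hS.ncard_image, Set.ncard_add_ncard_compl, Nat.card_prod,
    Nat.card_eq_fintype_card (α := Fin m), Fintype.card_fin]

/-- The two cardinality conditions agree: each edge that is not full accounts for exactly one
missing part, and each edge contributes `m - 1` new vertices. -/
theorem isSpanningTreeSet_pathPoint_iff {V E : Type} [Finite V] [Finite E] (a b : E → V) {m : ℕ}
    (hm : 1 ≤ m) (S : Set (E × Fin m)) :
    IsSpanningTreeSet (fun x : E × Fin m => pathPoint a b m x.1 x.2)
        (fun x => pathPoint a b m x.1 (x.2 + 1)) S ↔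
      Set.InjOn Prod.fst Sᶜ ∧ IsSpanningTreeSet a b (fullEdges S) := by
  unfold IsSpanningTreeSet
  rw [isConnecting_pathPoint_iff a b hm, and_assoc]
  refine and_congr_right fun hS => and_congr_right fun _ => ?_
  have h1 := ncard_add_ncard_compl_fullEdges hS
  have h2 := Set.ncard_add_ncard_compl (fullEdges S)
  have h3 : Nat.card (V ⊕ E × Fin (m - 1)) = Nat.card V + Nat.card E * (m - 1) := by
    simp [Nat.card_sum, Nat.card_prod]
  obtain ⟨m, rfl⟩ : ∃ k, m = k + 1 := ⟨m - 1, by omega⟩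
  rw [Nat.mul_succ] at h1
  rw [Nat.add_sub_cancel] at h3
  rw [Nat.add_sub_cancel, h3]
  omega

/-- A set of parts of edges that misses at most one part of each edge amounts to the set of its
full edges and a choice of one part of each other edge. -/
theorem bijective_missingPart {E : Type} {m : ℕ} (P : Set E → Prop) :
    Function.Bijective
      (fun x : (Σ T : {T : Set E // P T}, (↥(T.1ᶜ) → Fin m)) =>
        (⟨{y | ∀ h : y.1 ∈ x.1.1ᶜ, x.2 ⟨y.1, h⟩ ≠ y.2}, by
          have hfull : fullEdges {y : E × Fin m | ∀ h : y.1 ∈ x.1.1ᶜ, x.2 ⟨y.1, h⟩ ≠ y.2} =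
              x.1.1 := by
            ext e
            simp only [fullEdges, Set.mem_ofPred_eq]
            refine ⟨fun h => ?_, fun h k h' => (h' h).elim⟩
            by_contra he
            exact h _ he rfl
          refine ⟨?_, by rw [hfull]; exact x.1.2⟩
          rintro ⟨e, k⟩ hk ⟨e', l⟩ hl (rfl : e = e')
          simp only [Set.mem_compl_iff, Set.mem_ofPred_eq, not_forall, not_not] at hk hl
          obtain ⟨_, hk⟩ := hk
          obtain ⟨_, hl⟩ := hl
          rw [← hk, ← hl]⟩ :
        {S : Set (E × Fin m) // Set.InjOn Prod.fst Sᶜ ∧ P (fullEdges S)})) := by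
  constructor
  · rintro ⟨⟨T, hT⟩, g⟩ ⟨⟨T', hT'⟩, g'⟩ h
    have h := Set.ext_iff.1 (Subtype.ext_iff.1 h)
    simp only [Set.mem_ofPred_eq, Prod.forall] at h
    have hsub (e : E) : e ∈ T ↔ e ∈ T' := by
      constructor
      · intro he
        by_contra he'
        exact (h e (g' ⟨e, he'⟩)).1 (fun h' => (h' he).elim) he' rfl
      · intro he
        by_contra he'
        exact (h e (g ⟨e, he'⟩)).2 (fun h' => (h' he).elim) he' rfl
    obtain rfl : T = T' := Set.ext hsub
    congr
    ext1 ⟨e, he⟩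
    by_contra hne
    exact (h e (g ⟨e, he⟩)).2 (fun _ h' => hne h'.symm) he rfl
  · rintro ⟨S, hS, hP⟩
    have hex (e : ↥((fullEdges S)ᶜ)) : ∃ k, (e.1, k) ∉ S := by
      have := e.2
      simpa [fullEdges] using this
    choose g hg using hex
    refine ⟨⟨⟨fullEdges S, hP⟩, g⟩, Subtype.ext (Set.ext ?_)⟩
    rintro ⟨e, k⟩
    simp only [Set.mem_ofPred_eq]
    constructor
    · intro h
      by_contra hk
      have he : e ∈ (fullEdges S)ᶜ := fun he => hk (he k)
      exact h he (congrArg Prod.snd (hS (hg ⟨e, he⟩) hk rfl))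
    · rintro h he rfl
      exact hg ⟨e, he⟩ h

/-- Here `c` is the cyclomatic number, the size of the complement of any spanning tree; `hc` is
additive to avoid truncated subtraction. -/
theorem treeSetCount_pathPoint {V E : Type} [Finite V] [Finite E] (a b : E → V) {m c : ℕ}
    (hm : 1 ≤ m) (hc : c + Nat.card V = Nat.card E + 1) :
    treeSetCount (fun x : E × Fin m => pathPoint a b m x.1 x.2)
        (fun x => pathPoint a b m x.1 (x.2 + 1)) = treeSetCount a b * m ^ c := by
  classical
  unfold treeSetCount
  simp only [isSpanningTreeSet_pathPoint_iff a b hm]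
  rw [← Nat.card_eq_of_bijective _ (bijective_missingPart (IsSpanningTreeSet a b))]
  have := Fintype.ofFinite {T : Set E // IsSpanningTreeSet a b T}
  rw [Nat.card_sigma, Finset.sum_congr rfl (g := fun _ => m ^ c), Finset.sum_const,
    Finset.card_univ, smul_eq_mul, Nat.card_eq_fintype_card]
  rintro ⟨T, hT⟩ -
  rw [Nat.card_fun, Nat.card_coe_set_eq, Nat.card_eq_fintype_card, Fintype.card_fin]
  have h1 := Set.ncard_add_ncard_compl T
  have h2 := hT.2
  congr 1
  change Tᶜ.ncard = c
  omega

theorem isEdgeListing_edgePathGraph {V : Type} (G : SimpleGraph V) {m : ℕ} (hm : 1 ≤ m) :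
    IsEdgeListing (edgePathGraph G m)
      (fun x : G.edgeSet × Fin m => edgePathPoint G m x.1 x.2)
      (fun x => edgePathPoint G m x.1 (x.2 + 1)) := by
  have hG := isEdgeListing_out G
  have hinj : Function.Injective fun x : G.edgeSet × Fin m =>
      s(edgePathPoint G m x.1 x.2, edgePathPoint G m x.1 (x.2 + 1)) := by
    rintro ⟨e, k, hk⟩ ⟨e', l, hl⟩ h
    -- Without loops, the two halves of an edge stay distinct even when `m = 2`, where they share
    -- their only inner vertex.
    have hne := hG.ne e
    have hi := @hG.injective e e'
    simp only [Sym2.eq_iff] at h hi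
    suffices e = e' ∧ k = l by simpa
    unfold edgePathPoint at h
    split_ifs at h <;> grind
  have hne : ∀ x : G.edgeSet × Fin m,
      edgePathPoint G m x.1 x.2 ≠ edgePathPoint G m x.1 (x.2 + 1) := by
    rintro ⟨e, k, hk⟩ h
    have hne := hG.ne e
    unfold edgePathPoint at h
    split_ifs at h <;> grind
  convert isEdgeListing_fromEdgeSet hinj hne using 2
  unfold edgePathGraph
  congr 1
  ext s
  constructor
  · rintro ⟨e, k, hk, rfl⟩
    exact ⟨(e, ⟨k, hk⟩), rfl⟩
  · rintro ⟨⟨e, k⟩, rfl⟩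
    exact ⟨e, k, k.2, rfl⟩

theorem spanningTreeCount_edgePathGraph {V : Type} [Finite V] [Nonempty V] (G : SimpleGraph V)
    {m c : ℕ} (hm : 1 ≤ m) (hc : c + Nat.card V = Nat.card G.edgeSet + 1) :
    spanningTreeCount (edgePathGraph G m) = spanningTreeCount G * m ^ c := by
  rw [spanningTreeCount_eq_treeSetCount (isEdgeListing_out G),
    spanningTreeCount_eq_treeSetCount (isEdgeListing_edgePathGraph G hm)]
  exact treeSetCount_pathPoint (fun e : G.edgeSet => (Quot.out e.1).1)
    (fun e => (Quot.out e.1).2) hm hc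

theorem card_edgeSet_edgePathGraph {V : Type} (G : SimpleGraph V) {m : ℕ} (hm : 1 ≤ m) :
    Nat.card (edgePathGraph G m).edgeSet = Nat.card G.edgeSet * m := by
  rw [(isEdgeListing_edgePathGraph G hm).card_edgeSet]
  simp [Nat.card_prod]

/-! ### Attaching copies at vertices -/

theorem linkPoint_root {X V B : Type} (f : V → X) (r : B) (v : V) :
    linkPoint f r v r = Sum.inl (f v) := by
  simp [linkPoint]

theorem linkPoint_of_ne {X V B : Type} (f : V → X) {r b : B} (v : V) (h : b ≠ r) :
    linkPoint f r v b = Sum.inr (v, ⟨b, h⟩) := by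
  simp [linkPoint, h]

/-- The ends of the edges of a linked graph: of the edges of the old graph, and of the edges of
the copies attached. -/
noncomputable def linkEnd {X V B E F : Type} (φ : V → X) (r : B) (a : E → X) (p : F → B) :
    E ⊕ V × F → LinkVertex X V r :=
  Sum.elim (fun e => Sum.inl (a e)) (fun y => linkPoint φ r y.1 (p y.2))

theorem isConnecting_linkEnd_iff {X V B E F : Type} [Nonempty X] (φ : V → X) (r : B)
    (a b : E → X) (p q : F → B) (S : Set (E ⊕ V × F)) :
    IsConnecting (linkEnd φ r a p) (linkEnd φ r b q) S ↔
      IsConnecting a b (Sum.inl ⁻¹' S) ∧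
        ∀ v, IsConnecting p q ((fun y => Sum.inr (v, y)) ⁻¹' S) := by
  classical
  constructor
  · intro h
    constructor
    · intro f hf u v
      -- Each copy is collapsed onto its root.
      let g : LinkVertex X V r → Prop := Sum.elim f (fun y => f (φ y.1))
      have hg (w : V) (x : B) : g (linkPoint φ r w x) ↔ f (φ w) := by
        unfold linkPoint
        split_ifs <;> simp [g]
      refine h g ?_ (Sum.inl u) (Sum.inl v)
      rintro (e | ⟨w, y⟩) he
      · exact hf e he
      · simp only [linkEnd, Sum.elim_inr, hg]
    · intro v f hf x y
      -- Everything outside the copy at `v` is collapsed onto the root of that copy.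
      let g : LinkVertex X V r → Prop :=
        Sum.elim (fun _ => f r) (fun y => if y.1 = v then f y.2 else f r)
      have hg (w : V) (x : B) : g (linkPoint φ r w x) ↔ if w = v then f x else f r := by
        unfold linkPoint
        split_ifs <;> simp_all [g]
      have := h g ?_ (linkPoint φ r v x) (linkPoint φ r v y)
      · simpa only [hg, if_true] using this
      rintro (e | ⟨w, y⟩) he
      · rfl
      · simp only [linkEnd, Sum.elim_inr, hg]
        split_ifs with hw
        · subst hw
          exact hf y he
        · rfl
  · rintro ⟨h1, h2⟩ f hf
    have hX : ∀ u v : X, f (Sum.inl u) ↔ f (Sum.inl v) :=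
      h1 (fun x => f (Sum.inl x)) fun e he => hf (Sum.inl e) he
    have hB (v : V) (x : B) : f (linkPoint φ r v x) ↔ f (Sum.inl (φ v)) := by
      rw [← linkPoint_root φ r v]
      exact h2 v (fun x => f (linkPoint φ r v x)) (fun y hy => hf (Sum.inr (v, y)) hy) x r
    have hall (z : LinkVertex X V r) (u : X) : f z ↔ f (Sum.inl u) := by
      rcases z with x | ⟨v, x, hx⟩
      · exact hX x u
      · rw [← linkPoint_of_ne φ v hx, hB]
        exact hX _ _
    intro z z'
    obtain ⟨u⟩ := ‹Nonempty X›
    exact (hall z u).trans (hall z' u).symm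

theorem ncard_eq_ncard_preimage_inl_add_sum {E V F : Type} [Finite E] [Fintype V] [Finite F]
    (S : Set (E ⊕ V × F)) :
    S.ncard = (Sum.inl ⁻¹' S).ncard + ∑ v, ((fun y => Sum.inr (v, y)) ⁻¹' S : Set F).ncard := by
  have e : S ≃ ↥(Sum.inl ⁻¹' S : Set E) ⊕ Σ v, ↥((fun y => Sum.inr (v, y)) ⁻¹' S : Set F) :=
    { toFun := fun x => match x with
        | ⟨Sum.inl e, h⟩ => Sum.inl ⟨e, h⟩
        | ⟨Sum.inr (v, y), h⟩ => Sum.inr ⟨v, y, h⟩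
      invFun := fun x => match x with
        | Sum.inl ⟨e, h⟩ => ⟨Sum.inl e, h⟩
        | Sum.inr ⟨v, y, h⟩ => ⟨Sum.inr (v, y), h⟩
      left_inv := by rintro ⟨e | ⟨v, y⟩, h⟩ <;> rfl
      right_inv := by rintro (⟨e, h⟩ | ⟨v, y, h⟩) <;> rfl }
  have := Nat.card_congr e
  rwa [Nat.card_sum, Nat.card_sigma, Nat.card_coe_set_eq, Nat.card_coe_set_eq] at this

theorem card_linkVertex (X V : Type) {B : Type} [Finite X] [Finite V] [Finite B] (r : B) {n : ℕ}
    (hB : Nat.card B = n + 1) :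
    Nat.card (LinkVertex X V r) = Nat.card X + Nat.card V * n := by
  classical
  have := Fintype.ofFinite B
  have h : Nat.card {b : B // b ≠ r} = n := by
    rw [Nat.card_eq_fintype_card] at hB ⊢
    rw [Fintype.card_subtype_compl, Fintype.card_subtype_eq, hB]
    rfl
  rw [Nat.card_sum, Nat.card_prod, h]

/-- Connectedness bounds the number of edges in each piece from below, and the bounds add up to the
prescribed total, so all of them are equalities. -/
theorem isSpanningTreeSet_linkEnd_iff {X V B E F : Type} [Finite X] [Nonempty X] [Finite V]
    [Finite B] [Finite E] [Finite F] (φ : V → X) (r : B) (a b : E → X) (p q : F → B)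
    (S : Set (E ⊕ V × F)) :
    IsSpanningTreeSet (linkEnd φ r a p) (linkEnd φ r b q) S ↔
      IsSpanningTreeSet a b (Sum.inl ⁻¹' S) ∧
        ∀ v, IsSpanningTreeSet p q ((fun y => Sum.inr (v, y)) ⁻¹' S) := by
  have := Fintype.ofFinite V
  have : Nonempty B := ⟨r⟩
  unfold IsSpanningTreeSet
  rw [isConnecting_linkEnd_iff, forall_and, and_and_and_comm]
  refine and_congr_right fun ⟨h1, h2⟩ => ?_
  obtain ⟨n, hn⟩ : ∃ n, Nat.card B = n + 1 := Nat.exists_eq_succ_of_ne_zero Nat.card_pos.ne'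
  rw [ncard_eq_ncard_preimage_inl_add_sum, card_linkVertex X V r hn, hn]
  have h1 := h1.card_le
  have h2 (v : V) : n ≤ ((fun y => Sum.inr (v, y)) ⁻¹' S : Set F).ncard := by
    have := (h2 v).card_le
    omega
  have hs : ∑ _v : V, n = Nat.card V * n := by simp
  rw [← hs]
  have hle := Finset.sum_le_sum fun v (_ : v ∈ Finset.univ) => h2 v
  constructor
  · intro h
    refine ⟨by omega, fun v => ?_⟩
    have := (Finset.sum_eq_sum_iff_of_le fun v (_ : v ∈ Finset.univ) => h2 v).1 (by omega) v
      (Finset.mem_univ v)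
    omega
  · rintro ⟨h, h'⟩
    rw [Finset.sum_congr rfl fun v _ => Nat.succ_injective (h' v)]
    omega

theorem treeSetCount_linkEnd {X V B E F : Type} [Finite X] [Nonempty X] [Finite V]
    [Finite B] [Finite E] [Finite F] (φ : V → X) (r : B) (a b : E → X) (p q : F → B) :
    treeSetCount (linkEnd φ r a p) (linkEnd φ r b q) =
      treeSetCount a b * treeSetCount p q ^ Nat.card V := by
  unfold treeSetCount
  rw [← Nat.card_fun, ← Nat.card_prod]
  refine Nat.card_congr
    { toFun := fun S =>
        have h := (isSpanningTreeSet_linkEnd_iff φ r a b p q S.1).1 S.2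
        (⟨Sum.inl ⁻¹' S.1, h.1⟩, fun v => ⟨(fun y => Sum.inr (v, y)) ⁻¹' S.1, h.2 v⟩)
      invFun := fun x => ⟨{z | Sum.elim (fun e => e ∈ x.1.1) (fun y : V × F => y.2 ∈ (x.2 y.1).1) z},
        (isSpanningTreeSet_linkEnd_iff φ r a b p q _).2 ⟨x.1.2, fun v => (x.2 v).2⟩⟩
      left_inv := ?_
      right_inv := fun x => rfl }
  rintro ⟨S, hS⟩
  refine Subtype.ext (Set.ext ?_)
  rintro (e | ⟨v, y⟩) <;> rfl

theorem linkPoint_injective {X V B : Type} (φ : V → X) (r : B) (v : V) :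
    Function.Injective (linkPoint φ r v) := by
  intro x y h
  unfold linkPoint at h
  split_ifs at h <;> simp_all

theorem eq_of_linkPoint_eq {X V B : Type} {φ : V → X} {r : B} {v w : V} {x y : B} (hx : x ≠ r)
    (h : linkPoint φ r v x = linkPoint φ r w y) : v = w := by
  rw [linkPoint_of_ne φ v hx] at h
  unfold linkPoint at h
  split_ifs at h
  simp_all

/-- Even if `φ` gives several copies the same root, no edge is repeated: an edge of `K` has an end
other than `r`, and that end determines the copy. -/
theorem isEdgeListing_graphLink {X V B E F : Type} {G : SimpleGraph X} {K : SimpleGraph B}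
    (φ : V → X) (r : B) {a b : E → X} {p q : F → B} (hG : IsEdgeListing G a b)
    (hK : IsEdgeListing K p q) :
    IsEdgeListing (graphLink G φ K r) (linkEnd φ r a p) (linkEnd φ r b q) := by
  have hinl (e : E) (v : V) (y : F) : s((Sum.inl (a e) : LinkVertex X V r), Sum.inl (b e)) ≠
      s(linkPoint φ r v (p y), linkPoint φ r v (q y)) := by
    intro h
    have hne := hK.ne y
    rw [Sym2.eq_iff] at h
    unfold linkPoint at h
    split_ifs at h <;> simp_all
  have hinj : Function.Injective fun z => s(linkEnd φ r a p z, linkEnd φ r b q z) := by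
    rintro (e | ⟨v, y⟩) (e' | ⟨w, z⟩) h
    · simp only [linkEnd, Sum.elim_inl, Sym2.eq_iff, Sum.inl.injEq] at h
      rw [← Sym2.eq_iff] at h
      rw [hG.injective h]
    · exact (hinl _ _ _ h).elim
    · exact (hinl _ _ _ h.symm).elim
    · simp only [linkEnd, Sum.elim_inr] at h
      obtain rfl : v = w := by
        have hne := hK.ne y
        rw [Sym2.eq_iff] at h
        by_cases hp : p y = r
        · have hq : q y ≠ r := fun hq => hne (hp.trans hq.symm)
          rcases h with h | h
          · exact eq_of_linkPoint_eq hq h.2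
          · exact eq_of_linkPoint_eq hq h.2
        · rcases h with h | h
          · exact eq_of_linkPoint_eq hp h.1
          · exact eq_of_linkPoint_eq hp h.1
      have := hK.injective (Sym2.map.injective (linkPoint_injective φ r v) h)
      rw [this]
  have hne : ∀ z, linkEnd φ r a p z ≠ linkEnd φ r b q z := by
    rintro (e | ⟨v, y⟩) h
    · exact hG.ne e (Sum.inl_injective h)
    · exact hK.ne y (linkPoint_injective φ r v h)
  convert isEdgeListing_fromEdgeSet hinj hne using 2
  unfold graphLink
  rw [← hG.range_eq, ← hK.range_eq]
  congr 1
  ext s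
  simp only [Set.mem_union, Set.mem_image, Set.mem_range, Set.mem_iUnion, exists_exists_eq_and,
    Sum.exists, Prod.exists]
  rfl

theorem spanningTreeCount_graphLink {X V B : Type} [Finite X] [Nonempty X] [Finite V] [Finite B]
    (G : SimpleGraph X) (φ : V → X) (K : SimpleGraph B) (r : B) :
    spanningTreeCount (graphLink G φ K r) =
      spanningTreeCount G * spanningTreeCount K ^ Nat.card V := by
  have : Nonempty B := ⟨r⟩
  rw [spanningTreeCount_eq_treeSetCount (isEdgeListing_out G),
    spanningTreeCount_eq_treeSetCount (isEdgeListing_out K),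
    spanningTreeCount_eq_treeSetCount
      (isEdgeListing_graphLink φ r (isEdgeListing_out G) (isEdgeListing_out K)),
    treeSetCount_linkEnd]

theorem card_edgeSet_graphLink {X V B : Type} [Finite X] [Finite V] [Finite B]
    (G : SimpleGraph X) (φ : V → X) (K : SimpleGraph B) (r : B) :
    Nat.card (graphLink G φ K r).edgeSet =
      Nat.card G.edgeSet + Nat.card V * Nat.card K.edgeSet := by
  rw [(isEdgeListing_graphLink φ r (isEdgeListing_out G) (isEdgeListing_out K)).card_edgeSet,
    Nat.card_sum, Nat.card_prod]

/-! ### Closed walks and the trace of a matrix power -/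

theorem Fin.forall_of_forall_add_one {n : ℕ} [NeZero n] {P : Fin n → Prop} {j : Fin n} (hj : P j)
    (h : ∀ i, P i → P (i + 1)) (i : Fin n) : P i := by
  have key (k : ℕ) : P (j + Fin.ofNat n k) := by
    induction k with
    | zero => simpa using hj
    | succ k ih =>
      have := h _ ih
      rwa [add_assoc, show Fin.ofNat n k + 1 = Fin.ofNat n (k + 1) by
        ext; simp [Fin.val_add]] at this
  have := key (i - j).val
  simpa using this

/-- The arbitrary weight `g` on the two ends lets the induction absorb the first factor of the
product, and later lets the closing step of a cycle be inserted. -/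
theorem sum_prod_path_eq_pow {α R : Type} [Fintype α] [DecidableEq α] [CommSemiring R]
    (M : Matrix α α R) (k : ℕ) (g : α → α → R) :
    ∑ c : Fin (k + 1) → α, (∏ i : Fin k, M (c i.castSucc) (c i.succ)) * g (c 0) (c (Fin.last k)) =
      ∑ x, ∑ y, (M ^ k) x y * g x y := by
  induction k generalizing g with
  | zero =>
    rw [← (Equiv.funUnique (Fin 1) α).symm.sum_comp]
    simp [Matrix.one_apply]
  | succ k ih =>
    rw [← (Fin.consEquiv fun _ => α).sum_comp, Fintype.sum_prod_type]
    refine Finset.sum_congr rfl fun x _ => ?_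
    have := ih (fun z y => M x z * g x y)
    simp only [Fin.consEquiv, Equiv.coe_fn_mk, Fin.prod_univ_succ, Fin.castSucc_zero,
      Fin.cons_zero, Fin.cons_succ, ← Fin.succ_last, ← Fin.succ_castSucc]
    calc _ = ∑ c : Fin (k + 1) → α, (∏ i : Fin k, M (c i.castSucc) (c i.succ)) *
          (M x (c 0) * g x (c (Fin.last k))) := by
          refine Finset.sum_congr rfl fun c _ => ?_
          ring
      _ = _ := this
      _ = _ := by
        rw [Finset.sum_comm]
        refine Finset.sum_congr rfl fun y _ => ?_
        rw [pow_succ', Matrix.mul_apply, Finset.sum_mul]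
        refine Finset.sum_congr rfl fun z _ => ?_
        ring

theorem sum_prod_cycle_eq_trace_pow {α R : Type} [Fintype α] [DecidableEq α] [CommSemiring R]
    (M : Matrix α α R) (n : ℕ) [NeZero n] :
    ∑ c : Fin n → α, ∏ i : Fin n, M (c i) (c (i + 1)) = (M ^ n).trace := by
  obtain ⟨k, rfl⟩ : ∃ k, n = k + 1 := ⟨n - 1, by have := NeZero.ne n; omega⟩
  have := sum_prod_path_eq_pow M k (fun x y => M y x)
  simp only [Fin.prod_univ_castSucc, Fin.coeSucc_eq_succ, Fin.last_add_one]
  rw [this, pow_succ]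
  simp [Matrix.trace, Matrix.mul_apply]

/-! ### Words around the rim -/

/-- One step along the rim of a wheel. Here `x` and `y` say whether the current stretch of rim edges
has already met a spoke before and after the step, and `w` says whether the spoke at the rim vertex
passed and the rim edge that follows are present. -/
def WheelStep (x : Bool) (w : Bool × Bool) (y : Bool) : Prop :=
  x.toNat + w.1.toNat + w.2.toNat = 1 + y.toNat ∧ x.toNat + w.1.toNat ≤ 1

instance (x : Bool) (w : Bool × Bool) (y : Bool) : Decidable (WheelStep x w y) := by
  unfold WheelStep
  infer_instance

/-- The closed words of steps around the rim of the wheel. -/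
abbrev WheelWord (n : ℕ) [NeZero n] : Type :=
  {x : (Fin n → Bool) × (Fin n → Bool × Bool) // ∀ i, WheelStep (x.1 i) (x.2 i) (x.1 (i + 1))}

/-- The transfer matrix has trace 3 and determinant 1, so its power traces satisfy `t (k + 2) + t k
= 3 * t (k + 1)`, as do the Lucas numbers of even index; both sequences start with 2, 3. -/
theorem trace_pow_eq_lucas (n : ℕ) :
    ((Matrix.of fun x y : Bool => Nat.card {w : Bool × Bool // WheelStep x w y}) ^ n).trace =
      lucas (2 * n) := by
  set M : Matrix Bool Bool ℕ :=
    Matrix.of fun x y : Bool => Nat.card {w : Bool × Bool // WheelStep x w y} with hM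
  have h00 : M false false = 2 := by
    simp only [hM, Matrix.of_apply, Nat.card_eq_fintype_card]; decide
  have h01 : M false true = 1 := by
    simp only [hM, Matrix.of_apply, Nat.card_eq_fintype_card]; decide
  have h10 : M true false = 1 := by
    simp only [hM, Matrix.of_apply, Nat.card_eq_fintype_card]; decide
  have h11 : M true true = 1 := by
    simp only [hM, Matrix.of_apply, Nat.card_eq_fintype_card]; decide
  have hsq : M ^ 2 + 1 = 3 • M := by
    ext x y
    rcases x <;> rcases y <;> simp [pow_two, Matrix.mul_apply, h00, h01, h10, h11]
  have hrec (k : ℕ) : (M ^ (k + 2)).trace + (M ^ k).trace = 3 * (M ^ (k + 1)).trace := by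
    rw [← Matrix.trace_add, pow_add, ← mul_add_one, hsq, mul_smul_comm, ← pow_succ,
      Matrix.trace_smul, smul_eq_mul]
  have hlrec (k : ℕ) : lucas (2 * (k + 2)) + lucas (2 * k) = 3 * lucas (2 * (k + 1)) := by
    have h1 : lucas (2 * k + 4) = lucas (2 * k + 3) + lucas (2 * k + 2) := rfl
    have h2 : lucas (2 * k + 3) = lucas (2 * k + 2) + lucas (2 * k + 1) := rfl
    have h3 : lucas (2 * k + 2) = lucas (2 * k + 1) + lucas (2 * k) := rfl
    change lucas (2 * k + 4) + lucas (2 * k) = 3 * lucas (2 * k + 2)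
    omega
  induction n using Nat.twoStepInduction with
  | zero => simp [lucas]
  | one => simp [Matrix.trace, h00, h11, lucas]
  | more k h1 h2 =>
    have := hrec k
    have := hlrec k
    omega

theorem card_wheelWord (n : ℕ) [NeZero n] : Nat.card (WheelWord n) = lucas (2 * n) := by
  let e : WheelWord n ≃
      Σ c : Fin n → Bool, ∀ i, {w : Bool × Bool // WheelStep (c i) w (c (i + 1))} :=
    { toFun := fun x => ⟨x.1.1, fun i => ⟨x.1.2 i, x.2 i⟩⟩
      invFun := fun x => ⟨(x.1, fun i => (x.2 i).1), fun i => (x.2 i).2⟩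
      left_inv := fun _ => rfl
      right_inv := fun _ => rfl }
  rw [Nat.card_congr e, Nat.card_sigma, ← trace_pow_eq_lucas, ← sum_prod_cycle_eq_trace_pow]
  simp only [Nat.card_pi, Matrix.of_apply]

theorem wheelStep_self : ∀ b : Bool, WheelStep b (false, true) b := by
  decide

/-- With every rim edge present the state can never fall, so around a cycle it is constant. Then no
spoke occurs, and only the choice of the constant remains. -/
theorem card_wheelWord_rim (n : ℕ) [NeZero n] :
    Nat.card {x : WheelWord n // ∀ i, (x.1.2 i).2 = true} = 2 := by
  have hbij : Function.Bijective (fun b : Bool =>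
      (⟨⟨(fun _ => b, fun _ => (false, true)), fun _ => by revert b; exact wheelStep_self⟩, fun _ => rfl⟩ :
        {x : WheelWord n // ∀ i, (x.1.2 i).2 = true})) := by
    constructor
    · intro b b' h
      exact congrFun (congrArg (fun x => x.1.1.1) h) 0
    · rintro ⟨⟨⟨c, w⟩, hx⟩, hw⟩
      have hstep (i : Fin n) : c i = true → c (i + 1) = true := by
        have h := hx i
        have h' := hw i
        simp only at h h'
        revert h h'
        generalize c i = x
        generalize c (i + 1) = y
        rcases w i with ⟨s, e⟩
        revert x y s e
        decide
      obtain ⟨b, hb⟩ : ∃ b, ∀ i, c i = b := by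
        by_cases h : ∃ j, c j = true
        · obtain ⟨j, hj⟩ := h
          exact ⟨true, Fin.forall_of_forall_add_one hj hstep⟩
        · push Not at h
          exact ⟨false, by simpa using h⟩
      refine ⟨b, Subtype.ext (Subtype.ext (Prod.ext (funext fun i => (hb i).symm)
        (funext fun i => ?_)))⟩
      have h := hx i
      have h' := hw i
      simp only [hb] at h h' ⊢
      revert h h'
      rcases w i with ⟨s, e⟩
      clear hb
      revert b s e
      decide
  rw [← Nat.card_eq_of_bijective _ hbij]
  simp

/-! ### Spanning trees of the wheel -/

/-- The first ends of the edges of the wheel: of the spokes, then of the rim edges. -/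
def wheelFst (n : ℕ) : Fin n ⊕ Fin n → Option (Fin n) := Sum.elim (fun _ => none) some

/-- The second ends of the edges of the wheel: of the spokes, then of the rim edges. -/
def wheelSnd (n : ℕ) [NeZero n] : Fin n ⊕ Fin n → Option (Fin n) :=
  Sum.elim some (fun i => some (i + 1))

/-- The edges of the wheel that a word marks as present. -/
def wordEdges {n : ℕ} (w : Fin n → Bool × Bool) : Set (Fin n ⊕ Fin n) :=
  {z | Sum.elim (fun i => (w i).1) (fun i => (w i).2) z = true}

theorem ncard_wordEdges {n : ℕ} (w : Fin n → Bool × Bool) :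
    (wordEdges w).ncard = ∑ i, ((w i).1.toNat + (w i).2.toNat) := by
  classical
  have htoNat (b : Bool) : b.toNat = if b = true then 1 else 0 := by cases b <;> rfl
  rw [Finset.sum_add_distrib, wordEdges, Set.ncard_eq_toFinset_card']
  simp only [Set.toFinset_ofPred, Finset.card_filter, Fintype.sum_sum_type, Sum.elim_inl,
    Sum.elim_inr, htoNat]
  congr

theorem sum_add_one_eq {n : ℕ} [NeZero n] (f : Fin n → ℕ) : ∑ i, f (i + 1) = ∑ i, f i :=
  Equiv.sum_comp (Equiv.addRight (1 : Fin n)) f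

/-- A rim vertex in state `true` finds its spoke by going back, one in state `false` by going
forward; a search that never ends would make the rim full. Summing the step equations cancels the
states and leaves `n` edges. -/
theorem isSpanningTreeSet_wordEdges {n : ℕ} [NeZero n] (x : WheelWord n)
    (hx : ¬ ∀ i, (x.1.2 i).2 = true) :
    IsSpanningTreeSet (wheelFst n) (wheelSnd n) (wordEdges x.1.2) := by
  obtain ⟨⟨c, w⟩, hstep⟩ := x
  simp only at hstep hx ⊢
  constructor
  · intro f hf
    have hspoke (i : Fin n) (h : (w i).1 = true) : f none ↔ f (some i) := hf (Sum.inl i) h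
    have hrim (i : Fin n) (h : (w i).2 = true) : f (some i) ↔ f (some (i + 1)) :=
      hf (Sum.inr i) h
    have hback (i : Fin n) (h : c (i + 1) = true) :
        (w i).2 = true ∧ ((w i).1 = true ∨ c i = true) := by
      have := hstep i
      rw [h] at this
      revert this
      rcases w i with ⟨s, e⟩
      generalize c i = z
      revert s e z
      decide
    have hfwd (i : Fin n) (h : c i = false) (h' : (w i).1 = false) :
        (w i).2 = true ∧ c (i + 1) = false := by
      have := hstep i
      revert this h h'
      rcases w i with ⟨s, e⟩
      generalize c i = z
      generalize c (i + 1) = y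
      revert s e z y
      decide
    have h1 (i : Fin n) : c i = true → (f none ↔ f (some i)) := by
      by_contra hcon
      have hcon : c i = true ∧ ¬ (f none ↔ f (some i)) := by tauto
      -- Propagation backwards, written as forward propagation of the negation.
      have hall : ∀ i, ¬ ¬ (c i = true ∧ ¬ (f none ↔ f (some i))) := by
        intro k hk
        refine Fin.forall_of_forall_add_one
          (P := fun i => ¬ (c i = true ∧ ¬ (f none ↔ f (some i)))) hk ?_ i hcon
        rintro i hi ⟨h1, h2⟩
        obtain ⟨he, hor⟩ := hback i h1
        have := hrim i he
        have := hspoke i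
        tauto
      refine hx fun i => (hback i ?_).1
      have := hall (i + 1)
      tauto
    have h2 (i : Fin n) : c i = false → (f none ↔ f (some i)) := by
      by_contra hcon
      have hcon : c i = false ∧ ¬ (f none ↔ f (some i)) := by tauto
      have hs (i : Fin n) (h : ¬ (f none ↔ f (some i))) : (w i).1 = false := by
        have := hspoke i
        rw [← Bool.not_eq_true]
        tauto
      have hall : ∀ i, c i = false ∧ ¬ (f none ↔ f (some i)) := by
        refine Fin.forall_of_forall_add_one hcon ?_
        rintro i ⟨h1, h2⟩
        obtain ⟨he, hc⟩ := hfwd i h1 (hs i h2)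
        have := hrim i he
        exact ⟨hc, by tauto⟩
      exact hx fun i => (hfwd i (hall i).1 (hs i (hall i).2)).1
    have hall : ∀ v, f none ↔ f v := by
      rintro (_ | i)
      · rfl
      · rcases h : c i
        · exact h2 i h
        · exact h1 i h
    intro u v
    exact (hall u).symm.trans (hall v)
  · have hsum : ∑ i, ((c i).toNat + ((w i).1.toNat + (w i).2.toNat)) =
        ∑ i, (1 + (c (i + 1)).toNat) :=
      Finset.sum_congr rfl fun i _ => by rw [← (hstep i).1, add_assoc]
    rw [Finset.sum_add_distrib, Finset.sum_add_distrib (f := fun _ => 1),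
      sum_add_one_eq fun i => (c i).toNat] at hsum
    rw [ncard_wordEdges]
    simp only [Finset.sum_const, Finset.card_univ, Fintype.card_fin, smul_eq_mul, mul_one] at hsum
    simp only [Nat.card_eq_fintype_card, Fintype.card_option, Fintype.card_fin]
    omega

/-- The rim vertices reached from a spoke along at least one rim edge in the positive direction. -/
inductive ReachedFromSpoke {n : ℕ} [NeZero n] (w : Fin n → Bool × Bool) : Fin n → Prop
  | spoke (i : Fin n) (he : (w i).2 = true) (h : (w i).1 = true) : ReachedFromSpoke w (i + 1)
  | step (i : Fin n) (he : (w i).2 = true) (h : ReachedFromSpoke w i) : ReachedFromSpoke w (i + 1)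

/-- The rim vertices from which `i` is reached along rim edges in the positive direction. -/
inductive ReachesVertex {n : ℕ} [NeZero n] (w : Fin n → Bool × Bool) (i : Fin n) : Fin n → Prop
  | refl : ReachesVertex w i i
  | step (k : Fin n) (he : (w k).2 = true) (h : ReachesVertex w i (k + 1)) : ReachesVertex w i k

theorem reachedFromSpoke_add_one_iff {n : ℕ} [NeZero n] (w : Fin n → Bool × Bool) (i : Fin n) :
    ReachedFromSpoke w (i + 1) ↔ (w i).2 = true ∧ ((w i).1 = true ∨ ReachedFromSpoke w i) := by
  constructor
  · generalize hj : i + 1 = j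
    rintro (⟨k, he, h⟩ | ⟨k, he, h⟩)
    · obtain rfl := add_right_cancel hj
      exact ⟨he, Or.inl h⟩
    · obtain rfl := add_right_cancel hj
      exact ⟨he, Or.inr h⟩
  · rintro ⟨he, h | h⟩
    · exact .spoke i he h
    · exact .step i he h

/-- Otherwise the vertices that reach `i` along the rim have no spoke, and no present edge leaves
them because the rim edge after `i` is missing; they are cut off from the hub. -/
theorem spoke_or_reachedFromSpoke {n : ℕ} [NeZero n] {w : Fin n → Bool × Bool}
    (hw : IsConnecting (wheelFst n) (wheelSnd n) (wordEdges w)) {i : Fin n}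
    (hi : (w i).2 = false) : (w i).1 = true ∨ ReachedFromSpoke w i := by
  by_contra hcon
  have hreach (k : Fin n) (h : ReachesVertex w i k) :
      ¬ ((w k).1 = true ∨ ReachedFromSpoke w k) := by
    induction h with
    | refl => exact hcon
    | step k he _ ih => exact fun h => ih (Or.inr ((reachedFromSpoke_add_one_iff w k).2 ⟨he, h⟩))
  let f : Option (Fin n) → Prop := fun v => v.elim False (ReachesVertex w i)
  refine (hw f ?_ (some i) none).1 (ReachesVertex.refl : ReachesVertex w i i)
  rintro (k | k) hk
  · change False ↔ ReachesVertex w i k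
    exact ⟨False.elim, fun h => hreach k h (Or.inl hk)⟩
  · change ReachesVertex w i k ↔ ReachesVertex w i (k + 1)
    have hk : (w k).2 = true := hk
    refine ⟨fun h => ?_, fun h => .step k hk h⟩
    cases h with
    | refl => simp [hi] at hk
    | step _ _ h => exact h

/-- Connectedness gives one inequality per step; the number of edges makes their sum an equality,
hence each of them. -/
theorem exists_wheelWord_of_isSpanningTreeSet {n : ℕ} [NeZero n] {w : Fin n → Bool × Bool}
    (hw : IsSpanningTreeSet (wheelFst n) (wheelSnd n) (wordEdges w)) :
    ∃ c : Fin n → Bool, ∀ i, WheelStep (c i) (w i) (c (i + 1)) := by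
  classical
  let c : Fin n → Bool := fun i => decide (ReachedFromSpoke w i)
  have hc (i : Fin n) : c (i + 1) = ((w i).2 && ((w i).1 || c i)) := by
    simp only [c, reachedFromSpoke_add_one_iff, Bool.decide_and, Bool.decide_or,
      Bool.decide_eq_true]
  have hor (i : Fin n) (hi : (w i).2 = false) : ((w i).1 || c i) = true := by
    simpa [c] using spoke_or_reachedFromSpoke hw.1 hi
  have hle (i : Fin n) :
      1 + (c (i + 1)).toNat ≤ (c i).toNat + ((w i).1.toNat + (w i).2.toNat) := by
    rw [hc i]
    have := hor i
    revert this
    rcases w i with ⟨s, e⟩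
    generalize c i = z
    revert s e z
    decide
  have hcard := hw.2
  rw [ncard_wordEdges, Nat.card_eq_fintype_card, Fintype.card_option, Fintype.card_fin] at hcard
  have hsum : ∑ i, (1 + (c (i + 1)).toNat) =
      ∑ i, ((c i).toNat + ((w i).1.toNat + (w i).2.toNat)) := by
    rw [Finset.sum_add_distrib, Finset.sum_add_distrib, sum_add_one_eq fun i => (c i).toNat]
    simp only [Finset.sum_const, Finset.card_univ, Fintype.card_fin, smul_eq_mul, mul_one]
    omega
  have heq := (Finset.sum_eq_sum_iff_of_le fun i (_ : i ∈ Finset.univ) => hle i).1 hsum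
  refine ⟨c, fun i => ?_⟩
  have h1 := heq i (Finset.mem_univ i)
  have h2 := hor i
  rw [hc i] at h1 ⊢
  revert h1 h2
  rcases w i with ⟨s, e⟩
  generalize c i = z
  revert s e z
  decide

/-- The full rim already uses all `n` edges, which isolates the hub. -/
theorem not_isSpanningTreeSet_wordEdges {n : ℕ} [NeZero n] {w : Fin n → Bool × Bool}
    (h : ∀ i, (w i).2 = true) :
    ¬ IsSpanningTreeSet (wheelFst n) (wheelSnd n) (wordEdges w) := by
  rintro ⟨hw, hcard⟩
  rw [ncard_wordEdges, Nat.card_eq_fintype_card, Fintype.card_option, Fintype.card_fin] at hcard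
  simp only [h, Bool.toNat_true, Finset.sum_add_distrib, Finset.sum_const, Finset.card_univ,
    Fintype.card_fin, smul_eq_mul, mul_one] at hcard
  have hzero : ∑ i, (w i).1.toNat = 0 := by omega
  rw [Finset.sum_eq_zero_iff] at hzero
  refine (hw (fun v => v ≠ none) ?_ (some 0) none).1 (by simp) rfl
  rintro (k | k) hk
  · have hk : (w k).1 = true := hk
    have := hzero k (Finset.mem_univ k)
    simp [hk] at this
  · simp [wheelFst, wheelSnd]

theorem wordEdges_injective (n : ℕ) : Function.Injective (wordEdges (n := n)) := by
  intro w w' h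
  have h := Set.ext_iff.1 h
  funext i
  exact Prod.ext (Bool.eq_iff_iff.2 (h (Sum.inl i))) (Bool.eq_iff_iff.2 (h (Sum.inr i)))

theorem wordEdges_surjective (n : ℕ) : Function.Surjective (wordEdges (n := n)) := by
  classical
  intro S
  refine ⟨fun i => (decide (Sum.inl i ∈ S), decide (Sum.inr i ∈ S)), Set.ext ?_⟩
  rintro (i | i) <;> simp [wordEdges]

theorem treeSetCount_wheel (n : ℕ) [NeZero n] :
    treeSetCount (wheelFst n) (wheelSnd n) + 2 = lucas (2 * n) := by
  have hbij : Function.Bijective (fun x : {x : WheelWord n // ¬ ∀ i, (x.1.2 i).2 = true} =>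
      (⟨wordEdges x.1.1.2, isSpanningTreeSet_wordEdges x.1 x.2⟩ :
        {S // IsSpanningTreeSet (wheelFst n) (wheelSnd n) S})) := by
    constructor
    · rintro ⟨⟨⟨c, w⟩, h⟩, hw⟩ ⟨⟨⟨c', w'⟩, h'⟩, hw'⟩ heq
      obtain rfl : w = w' := wordEdges_injective n (Subtype.ext_iff.1 heq)
      simp only [not_forall] at h h' hw
      obtain ⟨k, hk⟩ := hw
      -- A missing rim edge resets the state to `false`, and a present one passes it on
      -- deterministically; so the edges determine all states once some rim edge is missing.
      have hkey : ∀ (x x' y y' : Bool) (v : Bool × Bool), WheelStep x v y → WheelStep x' v y' →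
          (v.2 ≠ true ∨ x = x') → y = y' := by
        unfold WheelStep
        decide
      have hall := Fin.forall_of_forall_add_one (P := fun i => c i = c' i)
        (hkey _ _ _ _ _ (h k) (h' k) (Or.inl hk))
        fun i hi => hkey _ _ _ _ _ (h i) (h' i) (Or.inr hi)
      obtain rfl : c = c' := funext hall
      rfl
    · rintro ⟨S, hS⟩
      obtain ⟨w, rfl⟩ := wordEdges_surjective n S
      obtain ⟨c, hc⟩ := exists_wheelWord_of_isSpanningTreeSet hS
      exact ⟨⟨⟨(c, w), hc⟩, fun h => not_isSpanningTreeSet_wordEdges h hS⟩, rfl⟩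
  classical
  rw [treeSetCount, ← Nat.card_eq_of_bijective _ hbij, ← card_wheelWord,
    add_comm, ← card_wheelWord_rim n, ← Nat.card_sum]
  exact Nat.card_congr (Equiv.sumCompl fun x : WheelWord n => ∀ i, (x.1.2 i).2 = true)

theorem isEdgeListing_wheelGraph (k : ℕ) :
    IsEdgeListing (wheelGraph (k + 3)) (wheelFst (k + 3)) (wheelSnd (k + 3)) := by
  -- This is where `n ≥ 3` matters: for `n = 2` the two rim edges would coincide.
  have htwo (i : Fin (k + 3)) : i + 1 + 1 ≠ i := by
    rw [add_assoc, Ne, add_eq_left]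
    simp only [Fin.ext_iff, Fin.val_add, Fin.val_one, Fin.val_zero]
    rw [Nat.mod_eq_of_lt (by omega)]
    omega
  constructor
  · rintro (i | i) (j | j) h
    · simpa [wheelFst, wheelSnd] using h
    · simp [wheelFst, wheelSnd] at h
    · simp [wheelFst, wheelSnd] at h
    · simp only [wheelFst, wheelSnd, Sum.elim_inr, Sym2.eq_iff, Option.some.injEq] at h
      rcases h with h | ⟨h1, h2⟩
      · rw [h.1]
      · exact (htwo j (h1 ▸ h2)).elim
  · ext s
    induction s with
    | _ u v =>
    rw [SimpleGraph.mem_edgeSet]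
    constructor
    · rintro ⟨i | i, h⟩
      · rcases Sym2.eq_iff.1 h with ⟨rfl, rfl⟩ | ⟨rfl, rfl⟩ <;> trivial
      · rcases Sym2.eq_iff.1 h with ⟨rfl, rfl⟩ | ⟨rfl, rfl⟩
        · change (SimpleGraph.cycleGraph (k + 1 + 2)).Adj i (i + 1)
          simp [SimpleGraph.cycleGraph_adj]
        · change (SimpleGraph.cycleGraph (k + 1 + 2)).Adj (i + 1) i
          simp [SimpleGraph.cycleGraph_adj]
    · intro h
      rcases u with _ | u <;> rcases v with _ | v
      · exact h.elim
      · exact ⟨Sum.inl v, rfl⟩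
      · exact ⟨Sum.inl u, Sym2.eq_swap⟩
      · have h : (SimpleGraph.cycleGraph (k + 1 + 2)).Adj u v := h
        rw [SimpleGraph.cycleGraph_adj] at h
        rcases h with h | h
        · obtain rfl := sub_eq_iff_eq_add'.1 h
          exact ⟨Sum.inr v, Sym2.eq_swap⟩
        · obtain rfl := sub_eq_iff_eq_add'.1 h
          exact ⟨Sum.inr u, rfl⟩

theorem spanningTreeCount_wheelGraph {n : ℕ} (hn : 3 ≤ n) :
    spanningTreeCount (wheelGraph n) + 2 = lucas (2 * n) := by
  obtain ⟨k, rfl⟩ := Nat.exists_eq_add_of_le' hn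
  rw [spanningTreeCount_eq_treeSetCount (isEdgeListing_wheelGraph k), treeSetCount_wheel]

theorem card_edgeSet_wheelGraph {n : ℕ} (hn : 3 ≤ n) :
    Nat.card (wheelGraph n).edgeSet = 2 * n := by
  obtain ⟨k, rfl⟩ := Nat.exists_eq_add_of_le' hn
  rw [(isEdgeListing_wheelGraph k).card_edgeSet, Nat.card_sum, Nat.card_eq_fintype_card,
    Fintype.card_fin, two_mul]

/-! ### The self-similar graphs -/

theorem wheelFractal_finite (m n : ℕ) (r : Option (Fin n)) (i : ℕ) :
    Finite (wheelFractal m n r i).Vertex := by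
  induction i with
  | zero => exact inferInstanceAs (Finite (Option (Fin n)))
  | succ i ih =>
    exact inferInstanceAs (Finite (LinkVertex
      (EdgePathVertex (wheelFractal m n r i).graph m) (wheelFractal m n r i).Vertex r))

theorem wheelFractal_nonempty (m n : ℕ) (r : Option (Fin n)) (i : ℕ) :
    Nonempty (wheelFractal m n r i).Vertex := by
  induction i with
  | zero => exact ⟨r⟩
  | succ i ih => exact ih.map fun v => Sum.inl (Sum.inl v)

theorem wheelFractalOrder_one (m n : ℕ) (r : Option (Fin n)) :
    wheelFractalOrder m n r 1 = n + 1 := by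
  change Nat.card (Option (Fin n)) = n + 1
  simp

theorem wheelFractalOrder_add_two (m n : ℕ) (r : Option (Fin n)) (i : ℕ) :
    wheelFractalOrder m n r (i + 2) = wheelFractalOrder m n r (i + 1) +
      Nat.card (wheelFractal m n r i).graph.edgeSet * (m - 1) +
        wheelFractalOrder m n r (i + 1) * n := by
  have := wheelFractal_finite m n r i
  refine (card_linkVertex (EdgePathVertex (wheelFractal m n r i).graph m)
    (wheelFractal m n r i).Vertex r (n := n) (by simp)).trans ?_
  rw [Nat.card_sum, Nat.card_prod, Nat.card_eq_fintype_card (α := Fin (m - 1)), Fintype.card_fin]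
  rfl

theorem card_edgeSet_wheelFractal_succ {m n : ℕ} (hm : 1 ≤ m) (hn : 3 ≤ n) (r : Option (Fin n))
    (i : ℕ) :
    Nat.card (wheelFractal m n r (i + 1)).graph.edgeSet =
      Nat.card (wheelFractal m n r i).graph.edgeSet * m +
        wheelFractalOrder m n r (i + 1) * (2 * n) := by
  have := wheelFractal_finite m n r i
  refine (card_edgeSet_graphLink (edgePathGraph (wheelFractal m n r i).graph m) Sum.inl
    (wheelGraph n) r).trans ?_
  rw [card_edgeSet_edgePathGraph _ hm, card_edgeSet_wheelGraph hn]
  rfl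

/-- The cyclomatic number of the self-similar graph. -/
theorem cyclomatic_wheelFractal {m n : ℕ} (hm : 1 ≤ m) (hn : 3 ≤ n) (r : Option (Fin n)) (i : ℕ) :
    n * ∑ j ∈ Finset.range (i + 1), wheelFractalOrder m n r j +
        Nat.card (wheelFractal m n r i).Vertex =
      Nat.card (wheelFractal m n r i).graph.edgeSet + 1 := by
  induction i with
  | zero =>
    have h1 : Nat.card (wheelFractal m n r 0).graph.edgeSet = 2 * n := card_edgeSet_wheelGraph hn
    have h2 : Nat.card (wheelFractal m n r 0).Vertex = n + 1 := wheelFractalOrder_one m n r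
    rw [h1, h2, zero_add, Finset.sum_range_one, wheelFractalOrder]
    ring
  | succ i ih =>
    have h1 := card_edgeSet_wheelFractal_succ hm hn r i
    have h2 : Nat.card (wheelFractal m n r (i + 1)).Vertex = _ := wheelFractalOrder_add_two m n r i
    have h3 : Nat.card (wheelFractal m n r i).Vertex = wheelFractalOrder m n r (i + 1) := rfl
    obtain ⟨m, rfl⟩ := Nat.exists_eq_add_of_le' hm
    rw [Nat.add_sub_cancel] at h2
    rw [Finset.sum_range_succ, h1, h2]
    rw [h3] at ih
    linarith

theorem spanningTreeCount_wheelFractal_succ {m n : ℕ} (hm : 1 ≤ m) (hn : 3 ≤ n)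
    (r : Option (Fin n)) (i : ℕ) :
    spanningTreeCount (wheelFractal m n r (i + 1)).graph =
      spanningTreeCount (wheelFractal m n r i).graph *
          m ^ (n * ∑ j ∈ Finset.range (i + 1), wheelFractalOrder m n r j) *
        spanningTreeCount (wheelGraph n) ^ wheelFractalOrder m n r (i + 1) := by
  have := wheelFractal_finite m n r i
  have := wheelFractal_nonempty m n r i
  refine (spanningTreeCount_graphLink (edgePathGraph (wheelFractal m n r i).graph m) Sum.inl
    (wheelGraph n) r).trans ?_
  rw [spanningTreeCount_edgePathGraph _ hm (cyclomatic_wheelFractal hm hn r i)]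
  rfl

theorem spanningTreeCount_wheelFractal {m n : ℕ} (hm : 1 ≤ m) (hn : 3 ≤ n)
    (r : Option (Fin n)) (i : ℕ) :
    spanningTreeCount (wheelFractal m n r i).graph =
      spanningTreeCount (wheelGraph n) ^ (∑ j ∈ Finset.range (i + 1), wheelFractalOrder m n r j) *
        m ^ (n * ∑ j ∈ Finset.range (i + 1), (i - j) * wheelFractalOrder m n r j) := by
  induction i with
  | zero => simp [wheelFractal, wheelFractalOrder]
  | succ i ih =>
    have hsum : ∑ j ∈ Finset.range (i + 1 + 1), (i + 1 - j) * wheelFractalOrder m n r j =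
        ∑ j ∈ Finset.range (i + 1), (i - j) * wheelFractalOrder m n r j +
          ∑ j ∈ Finset.range (i + 1), wheelFractalOrder m n r j := by
      -- The term `j = i + 1` vanishes; in the others `j ≤ i`, so the subtraction is not truncated.
      rw [Finset.sum_range_succ, Nat.sub_self, zero_mul, add_zero, ← Finset.sum_add_distrib]
      refine Finset.sum_congr rfl fun j hj => ?_
      rw [Finset.mem_range] at hj
      rw [Nat.succ_sub (by omega), Nat.succ_mul]
    rw [spanningTreeCount_wheelFractal_succ hm hn, ih, hsum,
      Finset.sum_range_succ _ (i + 1), mul_add, pow_add, pow_add]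
    ring

theorem mainTheorem2 (m n : ℕ) (hm : 1 ≤ m) (hn : 3 ≤ n) (r : Option (Fin n)) :
    (∀ i : ℕ,
      (spanningTreeCount (wheelFractal m n r i).graph : ℤ) =
        ((lucas (2 * n) : ℤ) - 2) ^ (∑ j ∈ Finset.range (i + 1), wheelFractalOrder m n r j) *
          (m : ℤ) ^ (n * ∑ j ∈ Finset.range (i + 1), (i - j) * wheelFractalOrder m n r j)) ∧
    wheelFractalOrder m n r 0 = 1 ∧
    wheelFractalOrder m n r 1 = n + 1 ∧
    (∀ i : ℕ, 2 ≤ i →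
      (wheelFractalOrder m n r i : ℤ) =
        ((n : ℤ) + m + 1) * wheelFractalOrder m n r (i - 1) +
          ((m : ℤ) * n - m - 2 * n) * wheelFractalOrder m n r (i - 2)) := by
  refine ⟨fun i => ?_, rfl, wheelFractalOrder_one m n r, fun i hi => ?_⟩
  · have hw : (lucas (2 * n) : ℤ) - 2 = (spanningTreeCount (wheelGraph n) : ℤ) := by
      rw [← spanningTreeCount_wheelGraph hn]
      push_cast
      ring
    rw [hw, spanningTreeCount_wheelFractal hm hn]
    push_cast
    rfl
  · obtain ⟨i, rfl⟩ := Nat.exists_eq_add_of_le' hi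
    have hcast : ((m - 1 : ℕ) : ℤ) = (m : ℤ) - 1 := by
      rw [Nat.cast_sub hm, Nat.cast_one]
    have h1 := congrArg (Nat.cast : ℕ → ℤ) (wheelFractalOrder_add_two m n r i)
    push_cast [hcast] at h1
    change (wheelFractalOrder m n r (i + 2) : ℤ) =
      ((n : ℤ) + m + 1) * wheelFractalOrder m n r (i + 1) +
        ((m : ℤ) * n - m - 2 * n) * wheelFractalOrder m n r i
    -- The first case is separate because the order at index 0 is a convention, not the vertex count
    -- of an earlier graph.
    rcases i with _ | i
    · have h2 : Nat.card (wheelFractal m n r 0).graph.edgeSet = 2 * n := card_edgeSet_wheelGraph hn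
      have h3 : wheelFractalOrder m n r 0 = 1 := rfl
      rw [h1, h2, h3, zero_add, wheelFractalOrder_one]
      push_cast
      ring
    · have h2 := congrArg (Nat.cast : ℕ → ℤ) (card_edgeSet_wheelFractal_succ hm hn r i)
      have h3 := congrArg (Nat.cast : ℕ → ℤ) (wheelFractalOrder_add_two m n r i)
      push_cast [hcast] at h2 h3
      rw [h1, h2]
      -- Subtracting `m` times the preceding vertex recursion eliminates the edge count.
      linear_combination (-(m : ℤ)) * h3
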